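/- Consider federated matrix factorization. Each user $u$ has an embedding $\mathbf p_u\in\mathbb R^d$, there is a shared item matrix $Q\in\mathbb R^{d\times N}$ with columns $\mathbf q_1,\dots,\mathbf q_N$, user $u$ has rated the items $j\in O_u$ with ratings $r_{uj}\in\mathbb{R}$, and its local loss is $\mathcal L_u(Q)=\frac12\sum_{j\in O_u}(r_{uj}-\mathbf q_j^\top\mathbf p_u)^2$. Fix a nonempty finite set $S$ of users, a learning rate $\eta\in\mathbb R$, an item $i$ and a rank $r\ge 1$. Let $\alpha_u=r_{ui}-\mathbf q_i^\top\mathbf p_u$ if $i\in O_u$ and $\alpha_u=0$ otherwise. For $u\in S$ let $\Delta_u=-\eta\nabla\mathcal L_u(Q)$ be the change of $Q$ in one full gradient step, and let $\bar\Delta_Q$ be the $i$-th column of $\frac1{|S|}\sum_{u\in S}\Delta_u$. For a matrix $B_u\in\mathbb R^{d\times r}$ let $A_u=-\eta\nabla_A\mathcal L_u(Q+B_uA)\big|_{A=0}\in\mathbb R^{r\times N}$ be the result of one gradient step in $A$ from $A=0$ with $B_u$ frozen, and let $\mathbf a_u$ be the $i$-th column of $A_u$. Suppose that the entries of each random matrix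 $B_u$ $(u\in S)$ are i.i.d. $\mathcal N(0,1/r)$ and that the $B_u$ are independent across users, and put $$\epsilon_i=\mathbb E_B\Big[\Big\|\bar\Delta_Q-\frac1{|S|}\sum_{u\in S}B_u\mathbf a_u\Big\|_2^2\Big].$$ Theorem. The squared error is integrable, and there is an absolute constant $C>0$ (independent of all the data, in particular of $d,r,N,S,\eta$) such that $$\epsilon_i\le\frac1{|S|}\,\eta^2\max_{u\in S}\alpha_u^2\|\mathbf p_u\|_2^2\cdot C\,\frac dr .$$ Moreover, the error grows as the rank decreases: with all other data fixed, if $1\le r<r'$, then $\epsilon_i$ for rank $r'$ is at most $\epsilon_i$ for rank $r$, and it is strictly smaller if $\eta\ne0$ and $\alpha_u\mathbf p_u\neq 0$ for some $u\in S$. -/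

import Mathlib

open MeasureTheory ProbabilityTheory
open scoped NNReal Matrix

/-- Real `d × N` matrices, given by their `N` columns in Euclidean `ℝᵈ`.  The inner product is the
Frobenius inner product, so gradients are the usual entrywise gradients. -/
abbrev ColMatrix (d N : ℕ) : Type := PiLp 2 (fun _ : Fin N => EuclideanSpace ℝ (Fin d))

/-- The state of federated matrix factorization at the start of a round: user embeddings `p u`,
the global item embedding matrix `Q` whose `j`-th column is the embedding of item `j`, the set
`O u` of items rated by user `u`, and the ratings `R u j` (only those with `j ∈ O u` are used). -/
structure FedMF (U : Type*) (d N : ℕ) where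
  p : U → EuclideanSpace ℝ (Fin d)
  Q : ColMatrix d N
  O : U → Finset (Fin N)
  R : U → Fin N → ℝ

/-- One gradient descent step for `f` from `x` with learning rate `η`. -/
noncomputable def gradStep {E : Type*} [NormedAddCommGroup E] [InnerProductSpace ℝ E]
    [CompleteSpace E] (η : ℝ) (f : E → ℝ) (x : E) : E :=
  x - η • gradient f x

/-- The matrix-vector product, on Euclidean spaces. -/
noncomputable def mulE {d r : ℕ} (B : Matrix (Fin d) (Fin r) ℝ) (a : EuclideanSpace ℝ (Fin r)) :
    EuclideanSpace ℝ (Fin d) :=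
  WithLp.toLp 2 (B *ᵥ (a : Fin r → ℝ))

/-- The matrix product `B A`, column by column. -/
noncomputable def mulCols {d r N : ℕ} (B : Matrix (Fin d) (Fin r) ℝ) (A : ColMatrix r N) :
    ColMatrix d N :=
  WithLp.toLp 2 (fun j => mulE B (A j))

namespace FedMF

variable {U : Type*} {d N : ℕ}

/-- The squared-error loss of user `u`, as a function of the item matrix `Q'`:
`(1/2) ∑_{j ∈ O_u} (r_{uj} - ⟨q'_j, p_u⟩)²`. -/
noncomputable def localLoss (D : FedMF U d N) (u : U) (Q' : ColMatrix d N) : ℝ :=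
  (1 / 2) * ∑ j ∈ D.O u, (D.R u j - inner ℝ (Q' j) (D.p u)) ^ 2

/-- The prediction residual `α_u = r_{ui} - ⟨q_i, p_u⟩` of user `u` on item `i`, masked to be `0`
if `u` has not rated `i`. -/
noncomputable def residual (D : FedMF U d N) (u : U) (i : Fin N) : ℝ :=
  if i ∈ D.O u then D.R u i - inner ℝ (D.Q i) (D.p u) else 0

/-- The unrestricted local update of the item matrix: the change of `Q` in one gradient step. -/
noncomputable def fullUpdate (D : FedMF U d N) (η : ℝ) (u : U) : ColMatrix d N :=
  gradStep η (D.localLoss u) D.Q - D.Q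

/-- The factor `A_u` obtained, with the projection matrix `B` frozen and the item matrix
parametrized as `Q + B A`, by one gradient step in `A` from the initial value `A = 0`. -/
noncomputable def localFactor {r : ℕ} (D : FedMF U d N) (η : ℝ) (u : U)
    (B : Matrix (Fin d) (Fin r) ℝ) : ColMatrix r N :=
  gradStep η (fun A : ColMatrix r N => D.localLoss u (D.Q + mulCols B A)) 0

/-- The squared Euclidean distance, for the embedding of item `i`, between the averaged
unrestricted update and the averaged low-rank update `(1/|S|) ∑_{u ∈ S} B_u a_u`, where `a_u` is
the `i`-th column of `A_u`. -/
noncomputable def sqError {r : ℕ} (D : FedMF U d N) (η : ℝ) (S : Finset U) (i : Fin N)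
    (B : U → Matrix (Fin d) (Fin r) ℝ) : ℝ :=
  ‖(1 / (S.card : ℝ)) • ∑ u ∈ S, (D.fullUpdate η u) i
    - (1 / (S.card : ℝ)) • ∑ u ∈ S, mulE (B u) ((D.localFactor η u (B u)) i)‖ ^ 2

/-- The expected squared error `ε_i` over the random projection matrices. -/
noncomputable def expError {r : ℕ} {Ω : Type*} [MeasurableSpace Ω] (D : FedMF U d N) (η : ℝ)
    (S : Finset U) (i : Fin N) (μ : Measure Ω) (B : U → Ω → Matrix (Fin d) (Fin r) ℝ) : ℝ :=
  ∫ ω, D.sqError η S i (fun u => B u ω) ∂μ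

end FedMF

/-- The matrices `B u`, `u ∈ S`, have i.i.d. `N(0, 1/r)` entries and are independent across users:
all their entries are jointly independent with law `N(0, 1/r)` (mean `0`, variance `1/r`). -/
structure IsGaussianProjection {U Ω : Type*} [MeasurableSpace Ω] {d r : ℕ} (μ : Measure Ω)
    (S : Finset U) (B : U → Ω → Matrix (Fin d) (Fin r) ℝ) : Prop where
  law : ∀ u ∈ S, ∀ (k : Fin d) (l : Fin r),
    HasLaw (fun ω => B u ω k l) (gaussianReal 0 ((r : ℝ≥0)⁻¹)) μ
  indep : iIndepFun (fun (x : S × Fin d × Fin r) (ω : Ω) => B x.1 ω x.2.1 x.2.2) μ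

/-! ### Gradient steps and the error in coordinates. -/

section Gradient

/-! The full step moves column `i` by `η α_u p_u`, and the low-rank step produces `B_u a_u = η α_u
B_u B_uᵀ p_u`. The error vector is therefore `(η/|S|) ∑ α_u (I - B_u B_uᵀ) p_u`, where each `B_u
B_uᵀ` has mean `I`. In coordinates it is a sum over (user, rank index, coordinate) of centered
products of two Gaussian entries (`sqError_eq`). Isserlis' theorem makes distinct terms uncorrelated
(`integral_entry_products`), so only variances survive, and `expError_eq` gives exactly `ε_i =
(η/|S|)² (∑ α_u² ‖p_u‖²) (d+1)/r`. Both claims are read off from this: the sum is at most `|S|`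
times its largest term, `d + 1 ≤ 2d` for `d ≥ 1`, and `1/r` is strictly decreasing. -/

theorem hasGradientAt_half_sum_sq {n N : ℕ} (O : Finset (Fin N)) (c : Fin N → ℝ)
    (w : EuclideanSpace ℝ (Fin n)) (A : ColMatrix n N) :
    HasGradientAt
      (fun A : ColMatrix n N => (1 / 2) * ∑ j ∈ O, (c j - inner ℝ (A j) w) ^ 2)
      (WithLp.toLp 2 fun j => -(if j ∈ O then c j - inner ℝ (A j) w else 0) • w) A := by
  rw [hasGradientAt_iff_hasFDerivAt]
  have h1 : ∀ j, HasFDerivAt (fun A : ColMatrix n N => c j - inner ℝ (A j) w)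
      (-((innerSL ℝ w).comp
        (PiLp.proj (𝕜 := ℝ) 2 (fun _ : Fin N => EuclideanSpace ℝ (Fin n)) j))) A := by
    intro j
    have := (((innerSL ℝ w).comp
        (PiLp.proj (𝕜 := ℝ) 2 (fun _ : Fin N => EuclideanSpace ℝ (Fin n)) j)).hasFDerivAt
          (x := A)).const_sub (c j)
    refine this.congr_of_eventuallyEq (Filter.Eventually.of_forall fun A => ?_)
    simp [real_inner_comm]
  have h2 := (HasFDerivAt.fun_sum (u := O) fun j _ => (h1 j).pow 2).const_mul (1 / 2 : ℝ)
  refine h2.congr_fderiv ?_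
  ext V
  rw [InnerProductSpace.toDual_apply_apply, PiLp.inner_apply]
  have h3 : ∀ j, inner ℝ (-(if j ∈ O then c j - inner ℝ (A j) w else 0) • w) (V j) =
      if j ∈ O then -(c j - inner ℝ (A j) w) * inner ℝ w (V j) else 0 := fun j => by
    split_ifs <;> simp [real_inner_smul_left]
  rw [Finset.sum_congr rfl fun j _ => h3 j, Finset.sum_ite_mem, Finset.univ_inter]
  simp only [smul_apply, sum_apply, smul_eq_mul, neg_apply,
    ContinuousLinearMap.comp_apply, innerSL_apply_apply,
    PiLp.proj_apply, nsmul_eq_mul, Finset.mul_sum]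
  refine Finset.sum_congr rfl fun j _ => ?_
  norm_num
  ring

/-- Serves both updates: with `w = p_u` at `Q`, and with `w = Bᵀ p_u` at `A = 0`. -/
theorem gradStep_half_sum_sq_sub {n N : ℕ} (η : ℝ) (O : Finset (Fin N)) (c : Fin N → ℝ)
    (w : EuclideanSpace ℝ (Fin n)) (A : ColMatrix n N) (i : Fin N) :
    (gradStep η (fun A : ColMatrix n N => (1 / 2) * ∑ j ∈ O, (c j - inner ℝ (A j) w) ^ 2) A
      - A) i = (η * if i ∈ O then c i - inner ℝ (A i) w else 0) • w := by
  rw [gradStep, (hasGradientAt_half_sum_sq O c w A).gradient]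
  simp [mul_smul]

theorem inner_mulE {d r : ℕ} (B : Matrix (Fin d) (Fin r) ℝ) (a : EuclideanSpace ℝ (Fin r))
    (p : EuclideanSpace ℝ (Fin d)) : inner ℝ (mulE B a) p = inner ℝ a (mulE Bᵀ p) := by
  simp only [mulE, EuclideanSpace.inner_eq_star_dotProduct, star_trivial]
  rw [Matrix.dotProduct_mulVec, ← Matrix.mulVec_transpose, dotProduct_comm]

namespace FedMF

variable {U : Type*} {d N : ℕ}

theorem fullUpdate_apply (D : FedMF U d N) (η : ℝ) (u : U) (i : Fin N) :
    (D.fullUpdate η u) i = (η * D.residual u i) • D.p u :=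
  gradStep_half_sum_sq_sub η (D.O u) (D.R u) (D.p u) D.Q i

/-- Moving `B` across the inner product turns the loss in `A` into least squares again, with
embedding `Bᵀ p_u` and the residuals at `Q` as targets. -/
theorem localFactor_apply {r : ℕ} (D : FedMF U d N) (η : ℝ) (u : U)
    (B : Matrix (Fin d) (Fin r) ℝ) (i : Fin N) :
    (D.localFactor η u B) i = (η * D.residual u i) • mulE Bᵀ (D.p u) := by
  have h : (fun A : ColMatrix r N => D.localLoss u (D.Q + mulCols B A)) =
      fun A : ColMatrix r N => (1 / 2) * ∑ j ∈ D.O u,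
        ((D.R u j - inner ℝ (D.Q j) (D.p u)) - inner ℝ (A j) (mulE Bᵀ (D.p u))) ^ 2 := by
    funext A
    simp only [localLoss, mulCols, PiLp.add_apply, inner_add_left, inner_mulE, sub_sub]
  have := gradStep_half_sum_sq_sub η (D.O u) (fun j => D.R u j - inner ℝ (D.Q j) (D.p u))
    (mulE Bᵀ (D.p u)) (0 : ColMatrix r N) i
  rw [sub_zero] at this
  rw [localFactor, h, this]
  simp [residual]

/-- The identity matrix is spread evenly over the `r` rank indices, `1/r` each, so that every single
summand is centered under the Gaussian law. -/
theorem sqError_eq {r : ℕ} (hr : 0 < r) (D : FedMF U d N) (η : ℝ) (S : Finset U) (i : Fin N)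
    (B : U → Matrix (Fin d) (Fin r) ℝ) :
    D.sqError η S i B = (η / S.card) ^ 2 * ∑ k, (∑ x : S × Fin r × Fin d,
      (D.residual x.1 i * D.p x.1 x.2.2) *
        (B x.1 k x.2.1 * B x.1 x.2.2 x.2.1 - if k = x.2.2 then (r : ℝ)⁻¹ else 0)) ^ 2 := by
  have hr' : (r : ℝ) ≠ 0 := by positivity
  rw [sqError, EuclideanSpace.norm_sq_eq, Finset.mul_sum]
  refine Finset.sum_congr rfl fun k _ => ?_
  -- The sign flips because the target has `B Bᵀ - I` and the error has `I - B Bᵀ`.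
  rw [Real.norm_eq_abs, sq_abs, ← mul_pow, ← neg_sq]
  congr 1
  rw [Fintype.sum_prod_type, Finset.sum_coe_sort S (fun u => ∑ x : Fin r × Fin d,
    (D.residual u i * D.p u x.2) * (B u k x.1 * B u x.2 x.1 - if k = x.2 then (r : ℝ)⁻¹ else 0))]
  simp only [fullUpdate_apply, localFactor_apply, PiLp.sub_apply, PiLp.smul_apply,
    smul_eq_mul, WithLp.ofLp_sum, Finset.sum_apply, ← mul_sub, ← Finset.sum_sub_distrib]
  rw [← mul_neg, ← Finset.sum_neg_distrib, Finset.mul_sum, Finset.mul_sum]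
  refine Finset.sum_congr rfl fun u _ => ?_
  have h1 : mulE (B u) ((η * D.residual u i) • mulE (B u)ᵀ (D.p u)) k =
      ∑ l, ∑ m, η * D.residual u i * (B u k l * B u m l * D.p u m) := by
    simp only [mulE, Matrix.mulVec, dotProduct, PiLp.smul_apply, smul_eq_mul,
      Matrix.transpose_apply, Finset.mul_sum]
    exact Finset.sum_congr rfl fun l _ => Finset.sum_congr rfl fun m _ => by ring
  have h2 : η * D.residual u i * D.p u k =
      ∑ l : Fin r, ∑ m, η * D.residual u i * ((if k = m then (r : ℝ)⁻¹ else 0) * D.p u m) := by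
    simp [ite_mul]
    field_simp
  rw [h1, h2, ← Finset.sum_sub_distrib, Fintype.sum_prod_type,
    ← Finset.sum_neg_distrib, Finset.mul_sum, Finset.mul_sum]
  refine Finset.sum_congr rfl fun l _ => ?_
  rw [← Finset.sum_sub_distrib, ← Finset.sum_neg_distrib, Finset.mul_sum, Finset.mul_sum]
  exact Finset.sum_congr rfl fun m _ => by ring

end FedMF

end Gradient

/-! ### Second and fourth moments of independent Gaussians. -/

section GaussianMoments

/-- The moment is the fourth derivative at `0` of the moment generating function `exp (v t² / 2)`.
-/
theorem integral_pow_four_gaussianReal (v : ℝ≥0) :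
    ∫ x, x ^ 4 ∂gaussianReal 0 v = 3 * (v : ℝ) ^ 2 := by
  have hg : ∀ t : ℝ, HasDerivAt (fun t : ℝ => Real.exp (v * t ^ 2 / 2))
      (v * t * Real.exp (v * t ^ 2 / 2)) t := by
    intro t
    have := ((((hasDerivAt_id t).pow 2).const_mul (v : ℝ)).div_const 2).exp
    refine this.congr_deriv ?_
    simp
    ring
  have h1 : deriv (fun t : ℝ => Real.exp (v * t ^ 2 / 2)) =
      fun t => v * t * Real.exp (v * t ^ 2 / 2) := funext fun t => (hg t).deriv
  have h2 : deriv (fun t : ℝ => v * t * Real.exp (v * t ^ 2 / 2)) =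
      fun t => (v + v ^ 2 * t ^ 2) * Real.exp (v * t ^ 2 / 2) := funext fun t => by
    refine ((((hasDerivAt_id t).const_mul (v : ℝ)).mul (hg t)).congr_deriv ?_).deriv
    simp
    ring
  have h3 : deriv (fun t : ℝ => (v + v ^ 2 * t ^ 2) * Real.exp (v * t ^ 2 / 2)) =
      fun t => (3 * v ^ 2 * t + v ^ 3 * t ^ 3) * Real.exp (v * t ^ 2 / 2) := funext fun t => by
    refine ((((((hasDerivAt_id t).pow 2).const_mul ((v : ℝ) ^ 2)).const_add (v : ℝ)).mul
      (hg t)).congr_deriv ?_).deriv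
    simp
    ring
  have h4 : deriv (fun t : ℝ => (3 * v ^ 2 * t + v ^ 3 * t ^ 3) * Real.exp (v * t ^ 2 / 2)) 0 =
      3 * (v : ℝ) ^ 2 := by
    refine (((((hasDerivAt_id (0 : ℝ)).const_mul (3 * (v : ℝ) ^ 2)).add
      (((hasDerivAt_id (0 : ℝ)).pow 3).const_mul ((v : ℝ) ^ 3))).mul (hg 0)).congr_deriv ?_).deriv
    simp
  calc ∫ x, x ^ 4 ∂gaussianReal 0 v
      = iteratedDeriv 4 (mgf (fun x => x) (gaussianReal 0 v)) 0 := by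
        rw [iteratedDeriv_mgf_zero] <;> simp
    _ = 3 * (v : ℝ) ^ 2 := by
        rw [mgf_fun_id_gaussianReal]
        simp only [zero_mul, zero_add]
        rw [iteratedDeriv_succ, iteratedDeriv_succ, iteratedDeriv_succ, iteratedDeriv_one,
          h1, h2, h3, h4]

theorem integral_sq_gaussianReal (v : ℝ≥0) : ∫ x, x ^ 2 ∂gaussianReal 0 v = v := by
  have h := variance_fun_id_gaussianReal (μ := 0) (v := v)
  rw [variance_eq_integral measurable_id'.aemeasurable] at h
  simpa using h

variable {ι Ω : Type*} [MeasurableSpace Ω] {μ : Measure Ω} {v : ℝ≥0}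
  {X : ι → Ω → ℝ}

theorem integral_pow_of_hasLaw_gaussianReal {Y : Ω → ℝ} (hY : HasLaw Y (gaussianReal 0 v) μ)
    (n : ℕ) : ∫ ω, Y ω ^ n ∂μ = ∫ x, x ^ n ∂gaussianReal 0 v :=
  hY.integral_comp (f := fun x => x ^ n) (by fun_prop)

theorem memLp_of_hasLaw_gaussianReal {Y : Ω → ℝ} (hY : HasLaw Y (gaussianReal 0 v) μ)
    {q : ENNReal} (hq : q ≠ ⊤) : MemLp Y q μ := by
  have h := memLp_id_gaussianReal' (μ := 0) (v := v) q hq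
  rw [← hY.map_eq] at h
  exact h.comp_of_map hY.aemeasurable

theorem memLp_two_mul_of_hasLaw_gaussianReal {Y Z : Ω → ℝ} (hY : HasLaw Y (gaussianReal 0 v) μ)
    (hZ : HasLaw Z (gaussianReal 0 v) μ) : MemLp (fun ω => Y ω * Z ω) 2 μ := by
  have : ENNReal.HolderTriple 4 4 2 := ⟨by
    rw [← two_mul, show (4 : ENNReal) = 2 * 2 by norm_num,
      ENNReal.mul_inv (by simp) (by simp), ← mul_assoc,
      ENNReal.mul_inv_cancel (by simp) (by simp), one_mul]⟩
  exact (memLp_of_hasLaw_gaussianReal hZ (q := 4) (by simp)).mul'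
    (memLp_of_hasLaw_gaussianReal hY (q := 4) (by simp))

variable (hX : ∀ x, HasLaw (X x) (gaussianReal 0 v) μ) (hind : iIndepFun X μ)

include hX hind

theorem integral_sq_mul_sq_iIndepFun_gaussianReal {a b : ι} (hab : a ≠ b) :
    ∫ ω, X a ω ^ 2 * X b ω ^ 2 ∂μ = (v : ℝ) ^ 2 := by
  have h : IndepFun (fun ω => X a ω ^ 2) (fun ω => X b ω ^ 2) μ :=
    (hind.indepFun hab).comp (φ := fun x => x ^ 2) (ψ := fun x => x ^ 2)
      (by fun_prop) (by fun_prop)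
  rw [h.integral_fun_mul_eq_mul_integral
    ((hX a).aemeasurable.pow_const 2).aestronglyMeasurable
    ((hX b).aemeasurable.pow_const 2).aestronglyMeasurable,
    integral_pow_of_hasLaw_gaussianReal (hX a), integral_pow_of_hasLaw_gaussianReal (hX b),
    integral_sq_gaussianReal, sq]

variable [DecidableEq ι]

theorem integral_mul_iIndepFun_gaussianReal (a b : ι) :
    ∫ ω, X a ω * X b ω ∂μ = if a = b then (v : ℝ) else 0 := by
  split_ifs with h
  · subst h
    rw [← integral_sq_gaussianReal v, ← integral_pow_of_hasLaw_gaussianReal (hX a)]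
    simp only [sq]
  · rw [(hind.indepFun h).integral_fun_mul_eq_mul_integral (hX a).aemeasurable.aestronglyMeasurable
      (hX b).aemeasurable.aestronglyMeasurable, (hX a).integral_eq]
    simp

/-- An index unlike the other three splits off by independence as a factor of mean zero. -/
theorem integral_mul_prod_eq_zero_of_notMem {a b c d : ι}
    (hb : a ≠ b) (hc : a ≠ c) (hd : a ≠ d) :
    ∫ ω, X a ω * (X b ω * (X c ω * X d ω)) ∂μ = 0 := by
  have h := hind.indepFun_finset₀ {a} {b, c, d} (by simp [hb, hc, hd])
    fun x => (hX x).aemeasurable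
  have h' : IndepFun (X a) (fun ω => X b ω * (X c ω * X d ω)) μ :=
    h.comp (φ := fun y : ({a} : Finset ι) → ℝ => y ⟨a, by simp⟩)
      (ψ := fun y : ({b, c, d} : Finset ι) → ℝ =>
        y ⟨b, by simp⟩ * (y ⟨c, by simp⟩ * y ⟨d, by simp⟩))
      (by fun_prop) (by fun_prop)
  have hm := fun x => (hX x).aemeasurable
  rw [h'.integral_fun_mul_eq_mul_integral (hX a).aemeasurable.aestronglyMeasurable
    ((hm b).mul ((hm c).mul (hm d))).aestronglyMeasurable, (hX a).integral_eq]
  simp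

/-- Isserlis' theorem for four members of an i.i.d. family of centered Gaussians. -/
theorem integral_mul_four_iIndepFun_gaussianReal (a b c d : ι) :
    ∫ ω, X a ω * (X b ω * (X c ω * X d ω)) ∂μ =
      (v : ℝ) ^ 2 * ((if a = b ∧ c = d then 1 else 0) + (if a = c ∧ b = d then 1 else 0)
        + if a = d ∧ b = c then 1 else 0) := by
  -- Up to reordering, either some index is unlike the other three (`key`), or there are two
  -- distinct equal pairs (`key2`), or all four agree, which gives the fourth moment.
  have key : ∀ {e f g h : ι}, e ≠ f → e ≠ g → e ≠ h →
      (∀ ω, X a ω * (X b ω * (X c ω * X d ω)) = X e ω * (X f ω * (X g ω * X h ω))) →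
      ∫ ω, X a ω * (X b ω * (X c ω * X d ω)) ∂μ = 0 := fun h1 h2 h3 h4 => by
    simp only [h4]
    exact integral_mul_prod_eq_zero_of_notMem hX hind h1 h2 h3
  have key2 : ∀ {e f : ι}, e ≠ f →
      (∀ ω, X a ω * (X b ω * (X c ω * X d ω)) = X e ω ^ 2 * X f ω ^ 2) →
      ∫ ω, X a ω * (X b ω * (X c ω * X d ω)) ∂μ = (v : ℝ) ^ 2 := fun h1 h2 => by
    simp only [h2]
    exact integral_sq_mul_sq_iIndepFun_gaussianReal hX hind h1
  by_cases hab : a = b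
  · subst hab
    by_cases hcd : c = d
    · subst hcd
      by_cases hac : a = c
      · subst hac
        have h : ∀ ω, X a ω * (X a ω * (X a ω * X a ω)) = X a ω ^ 4 := fun ω => by ring
        simp only [h]
        rw [integral_pow_of_hasLaw_gaussianReal (hX a), integral_pow_four_gaussianReal]
        norm_num
        ring
      · rw [key2 hac fun ω => by ring]
        simp [hac]
    · by_cases hac : a = c
      · subst hac
        rw [key (Ne.symm hcd) (Ne.symm hcd) (Ne.symm hcd) fun ω => by ring]
        simp [hcd]
      · rw [key (Ne.symm hac) (Ne.symm hac) hcd fun ω => by ring]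
        simp [hcd, hac]
  · by_cases hac : a = c
    · subst hac
      by_cases hbd : b = d
      · subst hbd
        rw [key2 hab fun ω => by ring]
        simp [hab]
      · rw [key (Ne.symm hab) (Ne.symm hab) hbd fun ω => by ring]
        simp [hab, hbd, Ne.symm hab]
    · by_cases had : a = d
      · subst had
        by_cases hbc : b = c
        · subst hbc
          rw [key2 hab fun ω => by ring]
          simp [hab]
        · rw [key (Ne.symm hab) (Ne.symm hab) hbc fun ω => by ring]
          simp [hab, hac, hbc]
      · rw [key hab hac had fun ω => by ring]
        simp [hab, hac, had]

/-- Centering subtracts the product of the means, which is exactly the Isserlis pairing of `a` with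
`b` and `c` with `d`; the two cross pairings remain. -/
theorem integral_centered_mul_centered [IsProbabilityMeasure μ] (a b c d : ι) :
    ∫ ω, (X a ω * X b ω - if a = b then (v : ℝ) else 0)
        * (X c ω * X d ω - if c = d then (v : ℝ) else 0) ∂μ =
      (v : ℝ) ^ 2 * ((if a = c ∧ b = d then 1 else 0) + if a = d ∧ b = c then 1 else 0) := by
  have i1 := memLp_two_mul_of_hasLaw_gaussianReal (hX a) (hX b)
  have i2 := memLp_two_mul_of_hasLaw_gaussianReal (hX c) (hX d)
  have hc : covariance (fun ω => X a ω * X b ω) (fun ω => X c ω * X d ω) μ = _ :=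
    covariance_eq_sub i1 i2
  rw [covariance, integral_mul_iIndepFun_gaussianReal hX hind,
    integral_mul_iIndepFun_gaussianReal hX hind] at hc
  rw [hc]
  simp only [Pi.mul_apply, mul_assoc]
  rw [integral_mul_four_iIndepFun_gaussianReal hX hind]
  by_cases h1 : a = b <;> by_cases h2 : c = d <;> simp [h1, h2]
  ring

end GaussianMoments

/-! ### Closed form of the expected error. -/

section ExpectedError

namespace FedMF

variable {U Ω : Type*} [MeasurableSpace Ω] {μ : Measure Ω} {d N r : ℕ}
  {S : Finset U} {B : U → Ω → Matrix (Fin d) (Fin r) ℝ}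

theorem sqError_eq_sum (hr : 0 < r) (D : FedMF U d N) (η : ℝ) (S : Finset U) (i : Fin N)
    (B : U → Matrix (Fin d) (Fin r) ℝ) :
    D.sqError η S i B = (η / S.card) ^ 2 * ∑ k, ∑ x : S × Fin r × Fin d, ∑ y : S × Fin r × Fin d,
      ((D.residual x.1 i * D.p x.1 x.2.2) * (D.residual y.1 i * D.p y.1 y.2.2)) *
        ((B x.1 k x.2.1 * B x.1 x.2.2 x.2.1 - if k = x.2.2 then (r : ℝ)⁻¹ else 0) *
        (B y.1 k y.2.1 * B y.1 y.2.2 y.2.1 - if k = y.2.2 then (r : ℝ)⁻¹ else 0)) := by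
  rw [sqError_eq hr]
  simp only [sq (∑ x : S × Fin r × Fin d, _), Finset.sum_mul_sum]
  congr 1
  refine Finset.sum_congr rfl fun k _ => Finset.sum_congr rfl fun x _ =>
    Finset.sum_congr rfl fun y _ => by ring

theorem integrable_entry_products [IsFiniteMeasure μ] (h : IsGaussianProjection μ S B) (k : Fin d)
    (x y : S × Fin r × Fin d) (s t : ℝ) :
    Integrable (fun ω => (B x.1 ω k x.2.1 * B x.1 ω x.2.2 x.2.1 - s) *
      (B y.1 ω k y.2.1 * B y.1 ω y.2.2 y.2.1 - t)) μ :=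
  have hm : ∀ (z : S × Fin r × Fin d) (s : ℝ),
      MemLp (fun ω => B z.1 ω k z.2.1 * B z.1 ω z.2.2 z.2.1 - s) 2 μ := fun z s =>
    (memLp_two_mul_of_hasLaw_gaussianReal (h.law _ z.1.2 k z.2.1)
      (h.law _ z.1.2 z.2.2 z.2.1)).sub (memLp_const s)
  (hm x s).integrable_mul (hm y t)

/-- Since both products share the row `k`, the straight pairing forces `x = y`, and the crossed
pairing forces in addition `k = x.2.2`. -/
theorem integral_entry_products [DecidableEq U] [IsProbabilityMeasure μ] (h : IsGaussianProjection μ S B)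
    (k : Fin d) (x y : S × Fin r × Fin d) :
    ∫ ω, (B x.1 ω k x.2.1 * B x.1 ω x.2.2 x.2.1 - if k = x.2.2 then (r : ℝ)⁻¹ else 0) *
      (B y.1 ω k y.2.1 * B y.1 ω y.2.2 y.2.1 - if k = y.2.2 then (r : ℝ)⁻¹ else 0) ∂μ =
      if x = y then ((r : ℝ)⁻¹) ^ 2 * (1 + if k = x.2.2 then 1 else 0) else 0 := by
  obtain ⟨u, l, m⟩ := x
  obtain ⟨u', l', m'⟩ := y
  have hw := integral_centered_mul_centered
    (fun x : S × Fin d × Fin r => h.law _ x.1.2 x.2.1 x.2.2) h.indep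
    (u, k, l) (u, m, l) (u', k, l') (u', m', l')
  simp only [Prod.mk.injEq, true_and, and_true, NNReal.coe_inv, NNReal.coe_natCast] at hw
  rw [hw]
  clear hw
  simp only [Prod.mk.injEq]
  by_cases hu : u = u' <;> by_cases hl : l = l' <;> by_cases hm : m = m' <;>
    by_cases hk : k = m <;> by_cases hk' : k = m' <;> simp_all [eq_comm]

theorem integrable_sqError [IsFiniteMeasure μ] (hr : 0 < r) (h : IsGaussianProjection μ S B)
    (D : FedMF U d N) (η : ℝ) (i : Fin N) :
    Integrable (fun ω => D.sqError η S i (fun u => B u ω)) μ := by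
  simp only [sqError_eq_sum hr]
  exact (integrable_finsetSum _ fun k _ => integrable_finsetSum _ fun x _ =>
    integrable_finsetSum _ fun y _ =>
      (integrable_entry_products h k x y _ _).const_mul _).const_mul _

/-- The expected squared error in closed form. -/
theorem expError_eq [IsProbabilityMeasure μ] (hr : 0 < r) (h : IsGaussianProjection μ S B)
    (D : FedMF U d N) (η : ℝ) (i : Fin N) :
    D.expError η S i μ B = (η / S.card) ^ 2 *
      ((∑ u ∈ S, D.residual u i ^ 2 * ‖D.p u‖ ^ 2) * ((d + 1) / r)) := by
  classical
  have hr' : (r : ℝ) ≠ 0 := by positivity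
  have hi : ∀ (k : Fin d) (x y : S × Fin r × Fin d), Integrable (fun ω =>
      ((D.residual x.1 i * D.p x.1 x.2.2) * (D.residual y.1 i * D.p y.1 y.2.2)) *
        ((B x.1 ω k x.2.1 * B x.1 ω x.2.2 x.2.1 - if k = x.2.2 then (r : ℝ)⁻¹ else 0) *
        (B y.1 ω k y.2.1 * B y.1 ω y.2.2 y.2.1 - if k = y.2.2 then (r : ℝ)⁻¹ else 0))) μ :=
    fun k x y => (integrable_entry_products h k x y _ _).const_mul _
  have hi₂ := fun k x => integrable_finsetSum Finset.univ fun y _ => hi k x y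
  have hi₃ := fun k => integrable_finsetSum Finset.univ fun x _ => hi₂ k x
  simp only [expError, sqError_eq_sum hr]
  rw [integral_const_mul, integral_finsetSum _ fun k _ => hi₃ k]
  congr 1
  simp only [integral_finsetSum _ fun x _ => hi₂ _ x, integral_finsetSum _ fun y _ => hi _ _ y,
    integral_const_mul, integral_entry_products h, mul_ite, mul_zero, Finset.sum_ite_eq,
    Finset.mem_univ, if_true]
  -- With `k` summed innermost, `∑ k, (1 + δ_km)` gives `d + 1`; the `r` rank indices turn `1/r²`
  -- into `1/r`.
  rw [Finset.sum_comm, Fintype.sum_prod_type, Finset.sum_mul,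
    ← Finset.sum_coe_sort S fun u => D.residual u i ^ 2 * ‖D.p u‖ ^ 2 * ((d + 1) / (r : ℝ))]
  refine Finset.sum_congr rfl fun u _ => ?_
  rw [Fintype.sum_prod_type]
  simp only [← Finset.mul_sum, Finset.sum_add_distrib, Finset.sum_ite_eq', Finset.mem_univ,
    if_true, Finset.sum_const, Finset.card_univ, Fintype.card_fin, nsmul_eq_mul, mul_one]
  rw [EuclideanSpace.norm_sq_eq, Finset.mul_sum, Finset.mul_sum, Finset.sum_mul]
  refine Finset.sum_congr rfl fun m _ => ?_
  rw [Real.norm_eq_abs, sq_abs]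
  field_simp

end FedMF

end ExpectedError

/-! ### The bound and monotonicity in the rank. -/

theorem mainTheorem1 :
    (∃ C : ℝ, 0 < C ∧
      ∀ (U : Type*) (Ω : Type*) [MeasurableSpace Ω] (μ : Measure Ω) [IsProbabilityMeasure μ]
        (d N r : ℕ) (_hr : 0 < r) (D : FedMF U d N) (η : ℝ) (S : Finset U) (hS : S.Nonempty)
        (i : Fin N) (B : U → Ω → Matrix (Fin d) (Fin r) ℝ),
        IsGaussianProjection μ S B →
          Integrable (fun ω => D.sqError η S i (fun u => B u ω)) μ ∧
          D.expError η S i μ B ≤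
            1 / (S.card : ℝ)
              * (η ^ 2 * S.sup' hS (fun u => D.residual u i ^ 2 * ‖D.p u‖ ^ 2))
              * (C * ((d : ℝ) / (r : ℝ)))) ∧
    (∀ (U : Type*) (Ω : Type*) [MeasurableSpace Ω] (μ : Measure Ω) [IsProbabilityMeasure μ]
        (Ω' : Type*) [MeasurableSpace Ω'] (μ' : Measure Ω') [IsProbabilityMeasure μ']
        (d N r r' : ℕ) (_hr : 0 < r) (_hrr' : r < r') (D : FedMF U d N) (η : ℝ) (S : Finset U)
        (i : Fin N) (B : U → Ω → Matrix (Fin d) (Fin r) ℝ)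
        (B' : U → Ω' → Matrix (Fin d) (Fin r') ℝ),
        IsGaussianProjection μ S B → IsGaussianProjection μ' S B' →
          D.expError η S i μ' B' ≤ D.expError η S i μ B ∧
          ((η ≠ 0 ∧ ∃ u ∈ S, D.residual u i ≠ 0 ∧ D.p u ≠ 0) →
            D.expError η S i μ' B' < D.expError η S i μ B)) := by
  -- `C = 2` absorbs `d + 1 ≤ 2d`.
  refine ⟨⟨2, two_pos, ?_⟩, ?_⟩
  · intro U Ω _ μ _ d N r hr D η S hS i B h
    refine ⟨FedMF.integrable_sqError hr h D η i, ?_⟩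
    rw [FedMF.expError_eq hr h]
    set M := S.sup' hS (fun u => D.residual u i ^ 2 * ‖D.p u‖ ^ 2) with hM
    have hc : (0 : ℝ) < S.card := by exact_mod_cast hS.card_pos
    have hr' : (0 : ℝ) < r := by exact_mod_cast hr
    have hsum : ∑ u ∈ S, D.residual u i ^ 2 * ‖D.p u‖ ^ 2 ≤ S.card * M := by
      rw [← nsmul_eq_mul]
      exact Finset.sum_le_card_nsmul _ _ _ fun u hu =>
        Finset.le_sup' (fun u => D.residual u i ^ 2 * ‖D.p u‖ ^ 2) hu
    have hM0 : 0 ≤ M := by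
      obtain ⟨u, hu⟩ := hS
      exact le_trans (by positivity)
        (Finset.le_sup' (fun u => D.residual u i ^ 2 * ‖D.p u‖ ^ 2) hu)
    -- For `d = 0` that inequality fails, but every embedding is zero and both sides vanish.
    rcases Nat.eq_zero_or_pos d with rfl | hd
    · have hp : ∀ u, D.p u = 0 := fun u => Subsingleton.elim _ _
      simp [hp]
    · have hd' : (1 : ℝ) ≤ d := by exact_mod_cast hd
      calc (η / S.card) ^ 2 *
            ((∑ u ∈ S, D.residual u i ^ 2 * ‖D.p u‖ ^ 2) * ((d + 1) / (r : ℝ)))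
          ≤ (η / S.card) ^ 2 * ((S.card * M) * ((d + d) / (r : ℝ))) := by gcongr
        _ = 1 / (S.card : ℝ) * (η ^ 2 * M) * (2 * ((d : ℝ) / (r : ℝ))) := by
          field_simp
          ring
  · intro U Ω _ μ _ Ω' _ μ' _ d N r r' hr hrr' D η S i B B' h h'
    rw [FedMF.expError_eq hr h, FedMF.expError_eq (hr.trans hrr') h']
    have hr0 : (0 : ℝ) < r := by exact_mod_cast hr
    have hlt : (r : ℝ) < r' := by exact_mod_cast hrr'
    -- Only the denominator of `(d + 1) / r` depends on the rank; strictness needs the remaining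
    -- factors positive.
    refine ⟨by gcongr, ?_⟩
    rintro ⟨hη, u, hu, hα, hp⟩
    have hc : (0 : ℝ) < S.card := by exact_mod_cast Finset.card_pos.mpr ⟨u, hu⟩
    have hpos : 0 < ∑ u ∈ S, D.residual u i ^ 2 * ‖D.p u‖ ^ 2 :=
      Finset.sum_pos' (fun _ _ => by positivity) ⟨u, hu, by positivity⟩
    have hη' : 0 < (η / S.card) ^ 2 := by positivity
    gcongr
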